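/- Let $p>3$ be a prime. Then $$\sum_{k=0}^{(p-1)/2}\frac{\binom{2k}{k}\binom{4k}{2k}}{64^k}\equiv(-1)^{\lfloor p/4\rfloor}\Bigl(1+P_{p-\left(\frac 2p\right)}\Bigr)\pmod{p^2},$$ where $\{P_n\}$ is the Pell sequence given by $P_0=0$, $P_1=1$, $P_{n+1}=2P_n+P_{n-1}$ $(n\ge 1)$, and $\left(\frac 2p\right)$ is the Legendre symbol. Here, for rational numbers $x$ and $y$, $x\equiv y\pmod{p^2}$ means that $x-y=p^2c$ for some rational number $c$ whose denominator in lowest terms is not divisible by $p$. -/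

import Mathlib

/-- The Pell sequence: `P 0 = 0`, `P 1 = 1`, `P (n + 2) = 2 P (n + 1) + P n`. -/
def pellSeq : ℕ → ℤ
  | 0 => 0
  | 1 => 1
  | (n + 2) => 2 * pellSeq (n + 1) + pellSeq n

/-- Congruence `x ≡ y (mod p ^ r)` of rational numbers, for a prime `p`: the difference `x - y` is
`p ^ r` times a rational number whose denominator (in lowest terms) is not divisible by `p`. -/
def RatModEq (p r : ℕ) (x y : ℚ) : Prop :=
  ∃ c : ℚ, ¬ p ∣ c.den ∧ x - y = (p : ℚ) ^ r * c

/-! ### Congruences of rationals modulo powers of `p`. -/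

section RatModEq

variable {p : ℕ} [hp : Fact p.Prime]

/-! Put `t = p/4`, `m = (p-1)/2`, `n = ⌊p/4⌋`, and let `H` denote harmonic numbers. The summand is
`binom x k * binom (-1-x) k` for both roots `x = -1/4, -3/4` of `x(x+1) = -3/16`, and `n - t` is one
of them. Let `S(x)` be the sum over `k ≤ m`. Then `S(x) + S(x-1)` is twice a truncated sine product,
so `S` can be carried from `-t`, which is divisible by `p`, up to `n - t`. This gives, mod `p²`,
`(-1)^n (1 + t (H_m + 2 ∑_{j<n} (-1)^j/(j+1)))` (`sum_binomProd_sub_quarter_modEq`).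

Both harmonic sums come from binomial sums: `p H_m ≡ 2 - 2^p`, and the alternating sum gives `4 (T -
1)/p` with `T = ∑_{4 ∣ i} (-1)^(i/4) binom p i`. It remains to see that `2(T-1) - (2^p-2)/4 ≡
P_{p-σ}`, where `σ = (2/p)`. Since `T ≡ 1` and `2^m ≡ σ` mod `p`, the left side is `T² - σ 2^m` mod
`p²`. Evaluating `T` through `(1+√2)^k` gives `T² = σ 2^m (1 + P_{p-σ}) + 3·2^b C²`; since `p`
divides `P_{p-σ}`, it divides `C`, and the claim follows (`signedBinomSum_sq_sub_modEq`). -/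

/-- The rational numbers whose denominator is prime to `p`. -/
def localRing (p : ℕ) [hp : Fact p.Prime] : Subring ℚ where
  carrier := {x | ¬ p ∣ x.den}
  zero_mem' := by simpa using hp.out.one_lt.ne'
  one_mem' := by simpa using hp.out.one_lt.ne'
  add_mem' {a b} ha hb h := by
    rcases hp.out.dvd_mul.1 (h.trans (Rat.add_den_dvd a b)) with h | h
    exacts [ha h, hb h]
  mul_mem' {a b} ha hb h := by
    rcases hp.out.dvd_mul.1 (h.trans (Rat.mul_den_dvd a b)) with h | h
    exacts [ha h, hb h]
  neg_mem' {a} ha := by simpa using ha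

theorem inv_natCast_mem {k : ℕ} (h : ¬ p ∣ k) : (k : ℚ)⁻¹ ∈ localRing p := by
  change ¬ p ∣ ((k : ℚ)⁻¹).den
  rcases Nat.eq_zero_or_pos k with rfl | hk
  · simp at h
  · rwa [Rat.inv_natCast_den_of_pos hk]

theorem inv_succ_mem {k : ℕ} (h : k + 1 < p) : ((k : ℚ) + 1)⁻¹ ∈ localRing p := by
  have := inv_natCast_mem (p := p) (k := k + 1) (Nat.not_dvd_of_pos_of_lt (by omega) h)
  simpa using this

theorem ratModEq_iff {r : ℕ} {x y : ℚ} :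
    RatModEq p r x y ↔ ∃ c ∈ localRing p, x - y = (p : ℚ) ^ r * c := Iff.rfl

namespace RatModEq

variable {r : ℕ} {x y z x' y' c : ℚ}

theorem refl (x : ℚ) : RatModEq p r x x := ratModEq_iff.2 ⟨0, zero_mem _, by simp⟩

theorem of_eq (h : x = y) : RatModEq p r x y := h ▸ refl x

theorem symm (h : RatModEq p r x y) : RatModEq p r y x := by
  obtain ⟨c, hc, h⟩ := ratModEq_iff.1 h
  exact ratModEq_iff.2 ⟨-c, neg_mem hc, by linear_combination -h⟩

theorem trans (h : RatModEq p r x y) (h' : RatModEq p r y z) : RatModEq p r x z := by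
  obtain ⟨c, hc, h⟩ := ratModEq_iff.1 h
  obtain ⟨d, hd, h'⟩ := ratModEq_iff.1 h'
  exact ratModEq_iff.2 ⟨c + d, add_mem hc hd, by linear_combination h + h'⟩

theorem add (h : RatModEq p r x y) (h' : RatModEq p r x' y') :
    RatModEq p r (x + x') (y + y') := by
  obtain ⟨c, hc, h⟩ := ratModEq_iff.1 h
  obtain ⟨d, hd, h'⟩ := ratModEq_iff.1 h'
  exact ratModEq_iff.2 ⟨c + d, add_mem hc hd, by linear_combination h + h'⟩

theorem mul_left (hc : c ∈ localRing p) (h : RatModEq p r x y) :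
    RatModEq p r (c * x) (c * y) := by
  obtain ⟨d, hd, h⟩ := ratModEq_iff.1 h
  exact ratModEq_iff.2 ⟨c * d, mul_mem hc hd, by linear_combination c * h⟩

theorem sub (h : RatModEq p r x y) (h' : RatModEq p r x' y') :
    RatModEq p r (x - x') (y - y') := by
  obtain ⟨c, hc, h⟩ := ratModEq_iff.1 h
  obtain ⟨d, hd, h'⟩ := ratModEq_iff.1 h'
  exact ratModEq_iff.2 ⟨c - d, sub_mem hc hd, by linear_combination h - h'⟩

theorem sum {ι : Type*} {s : Finset ι} {f g : ι → ℚ} (h : ∀ i ∈ s, RatModEq p r (f i) (g i)) :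
    RatModEq p r (∑ i ∈ s, f i) (∑ i ∈ s, g i) := by
  classical
  induction s using Finset.induction_on with
  | empty => exact refl _
  | insert a s ha ih =>
    rw [Finset.sum_insert ha, Finset.sum_insert ha]
    exact (h a (by simp)).add (ih fun i hi => h i (by simp [hi]))

theorem prime_mul (h : RatModEq p r x y) : RatModEq p (r + 1) (p * x) (p * y) := by
  obtain ⟨c, hc, h⟩ := ratModEq_iff.1 h
  exact ratModEq_iff.2 ⟨c, hc, by linear_combination (p : ℚ) * h⟩

theorem of_int_modEq {a b : ℤ} (h : (p : ℤ) ^ r ∣ a - b) : RatModEq p r a b := by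
  obtain ⟨c, hc⟩ := h
  exact ratModEq_iff.2 ⟨c, intCast_mem _ c, by exact_mod_cast hc⟩

theorem mem (h : RatModEq p r x y) (hy : y ∈ localRing p) : x ∈ localRing p := by
  obtain ⟨c, hc, h⟩ := ratModEq_iff.1 h
  rw [sub_eq_iff_eq_add.1 h]
  exact add_mem (mul_mem (pow_mem (natCast_mem _ p) _) hc) hy

end RatModEq

end RatModEq

/-! ### Recurrences in `x` for the truncated sums. -/

section Telescoping

open Finset

/-- The product `binom x k * binom (-1 - x) k`. -/
def binomProd (x : ℚ) (k : ℕ) : ℚ :=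
  ∏ i ∈ range k, (((i : ℚ) + 1) * i - x * (x + 1)) / ((i : ℚ) + 1) ^ 2

/-- The truncated sine product `∏ (1 - x ^ 2 / i ^ 2)` over `1 ≤ i ≤ m`. -/
def sineProd (x : ℚ) (m : ℕ) : ℚ :=
  ∏ i ∈ range m, (1 - x ^ 2 / ((i : ℚ) + 1) ^ 2)

theorem binomProd_succ (x : ℚ) (k : ℕ) : binomProd x (k + 1) =
    binomProd x k * ((((k : ℚ) + 1) * k - x * (x + 1)) / ((k : ℚ) + 1) ^ 2) :=
  prod_range_succ _ _

theorem sineProd_succ (x : ℚ) (k : ℕ) :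
    sineProd x (k + 1) = sineProd x k * (1 - x ^ 2 / ((k : ℚ) + 1) ^ 2) :=
  prod_range_succ _ _

/-- The numerators factor as `(i - x)(i + 1 + x)`; pairing `i + x` with `i - x` leaves only the two
end factors. -/
theorem binomProd_succ_eq_sineProd (x : ℚ) (m : ℕ) :
    binomProd x (m + 1) = sineProd x m * (-x * (x + m + 1) / ((m : ℚ) + 1) ^ 2) := by
  induction m with
  | zero => simp [binomProd, sineProd]
  | succ m ih =>
    have h1 : (m : ℚ) + 1 ≠ 0 := by positivity
    have h2 : (m : ℚ) + 1 + 1 ≠ 0 := by positivity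
    rw [binomProd_succ, ih, sineProd_succ]
    push_cast
    field_simp
    ring

theorem binomProd_sub_one_succ_eq_sineProd (x : ℚ) (m : ℕ) :
    binomProd (x - 1) (m + 1) = sineProd x m * (x * (m + 1 - x) / ((m : ℚ) + 1) ^ 2) := by
  induction m with
  | zero => simp [binomProd, sineProd]; ring
  | succ m ih =>
    have h1 : (m : ℚ) + 1 ≠ 0 := by positivity
    have h2 : (m : ℚ) + 1 + 1 ≠ 0 := by positivity
    rw [binomProd_succ, ih, sineProd_succ]
    push_cast
    field_simp
    ring

/-- The two new terms at `m + 1` add up to `-2x²/(m+1)²` times `sineProd x m`, which is the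
increment of `2 * sineProd x`. -/
theorem sum_binomProd_add_sum_binomProd_sub_one (x : ℚ) (m : ℕ) :
    ∑ k ∈ range (m + 1), binomProd x k + ∑ k ∈ range (m + 1), binomProd (x - 1) k =
      2 * sineProd x m := by
  induction m with
  | zero => norm_num [binomProd, sineProd]
  | succ m ih =>
    have h1 : (m : ℚ) + 1 ≠ 0 := by positivity
    rw [sum_range_succ, sum_range_succ _ (m + 1), binomProd_succ_eq_sineProd,
      binomProd_sub_one_succ_eq_sineProd, sineProd_succ]
    have h : sineProd x m * (-x * (x + m + 1) / ((m : ℚ) + 1) ^ 2) +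
        sineProd x m * (x * (m + 1 - x) / ((m : ℚ) + 1) ^ 2) =
        2 * (sineProd x m * (1 - x ^ 2 / ((m : ℚ) + 1) ^ 2)) - 2 * sineProd x m := by
      field_simp
      ring
    linear_combination ih + h

/-- Under `x ↦ x + 1` the factors `i - x` and `i + x` of the product shift by one place, so only end
factors change. Denominators are cleared. -/
theorem sineProd_add_one (x : ℚ) (m : ℕ) :
    sineProd (x + 1) m * ((m - x) * (x + 1)) = -x * (m + x + 1) * sineProd x m := by
  induction m with
  | zero => simp [sineProd]
  | succ m ih =>
    have h1 : (m : ℚ) + 1 ≠ 0 := by positivity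
    rw [sineProd_succ, sineProd_succ]
    push_cast
    have h : sineProd (x + 1) m * (1 - (x + 1) ^ 2 / ((m : ℚ) + 1) ^ 2) * ((m + 1 - x) * (x + 1)) =
        sineProd (x + 1) m * ((m - x) * (x + 1)) * ((m + x + 2) * (m + 1 - x) / ((m : ℚ) + 1) ^ 2)
        := by
      field_simp
      ring
    rw [h, ih]
    field_simp
    ring

theorem choose_mul_choose_div_eq_binomProd {x : ℚ} (hx : x * (x + 1) = -3 / 16) (k : ℕ) :
    ((Nat.choose (2 * k) k : ℚ) * (Nat.choose (4 * k) (2 * k) : ℚ)) / (64 : ℚ) ^ k =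
      binomProd x k := by
  have e (k : ℕ) : Nat.choose (4 * k) (2 * k) = Nat.centralBinom (2 * k) := by
    rw [Nat.centralBinom]; congr 1; ring
  induction k with
  | zero => simp [binomProd]
  | succ k ih =>
    rw [binomProd_succ, ← ih, e, e, hx, ← Nat.centralBinom, ← Nat.centralBinom]
    have h1 : ((k : ℚ) + 1) * (k + 1).centralBinom = 2 * (2 * k + 1) * k.centralBinom := by
      exact_mod_cast Nat.succ_mul_centralBinom_succ k
    have h2 : (2 * (k : ℚ) + 1) * (2 * k + 1).centralBinom =
        2 * (2 * (2 * k) + 1) * (2 * k).centralBinom := by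
      exact_mod_cast Nat.succ_mul_centralBinom_succ (2 * k)
    have h3 : (2 * (k : ℚ) + 1 + 1) * (2 * (k + 1)).centralBinom =
        2 * (2 * (2 * k + 1) + 1) * (2 * k + 1).centralBinom := by
      exact_mod_cast Nat.succ_mul_centralBinom_succ (2 * k + 1)
    have k1 : (k : ℚ) + 1 ≠ 0 := by positivity
    have k2 : 2 * (k : ℚ) + 1 ≠ 0 := by positivity
    have h4 : ((k + 1).centralBinom : ℚ) = 2 * (2 * k + 1) * k.centralBinom / (k + 1) := by
      rw [eq_div_iff k1]; linear_combination h1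
    have h5 : ((2 * k + 1).centralBinom : ℚ) =
        2 * (2 * (2 * k) + 1) * (2 * k).centralBinom / (2 * k + 1) := by
      rw [eq_div_iff k2]; linear_combination h2
    have h6 : ((2 * (k + 1)).centralBinom : ℚ) =
        (2 * (2 * k + 1) + 1) * (2 * k + 1).centralBinom / (k + 1) := by
      rw [eq_div_iff k1]; linear_combination h3 / 2
    rw [h6, h5, h4, pow_succ]
    field_simp
    ring

end Telescoping

/-! ### The sum at `n - p/4` modulo `p²`. -/

section TruncatedSum

open Finset

variable {p : ℕ} [hp : Fact p.Prime]

theorem inv_intCast_mem {a : ℤ} (h : ¬ (p : ℤ) ∣ a) : (a : ℚ)⁻¹ ∈ localRing p := by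
  rw [Int.natCast_dvd] at h
  have := inv_natCast_mem h
  rcases Int.natAbs_eq a with e | e <;> rw [e]
  · simpa using this
  · simpa [inv_neg] using this

theorem RatModEq.of_mul_left {r : ℕ} {c x y : ℚ} (hc : c ≠ 0) (hc' : c⁻¹ ∈ localRing p)
    (h : RatModEq p r (c * x) (c * y)) : RatModEq p r x y := by
  simpa [inv_mul_cancel_left₀ hc] using h.mul_left hc'

theorem inv_four_mem (hp2 : p ≠ 2) : (4 : ℚ)⁻¹ ∈ localRing p := by
  refine inv_natCast_mem (k := 4) fun h => hp2 ?_
  exact (Nat.prime_dvd_prime_iff_eq hp.out Nat.prime_two).1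
    (hp.out.dvd_of_dvd_pow (n := 2) (by simpa using h))

theorem quarter_mem (hp2 : p ≠ 2) : (p : ℚ) / 4 ∈ localRing p :=
  mul_mem (natCast_mem _ p) (inv_four_mem hp2)

theorem RatModEq.of_sub_eq_quarter_sq {x y c : ℚ} (hp2 : p ≠ 2) (hc : c ∈ localRing p)
    (h : x - y = ((p : ℚ) / 4) ^ 2 * c) : RatModEq p 2 x y :=
  ratModEq_iff.2 ⟨4⁻¹ * 4⁻¹ * c, mul_mem (mul_mem (inv_four_mem hp2) (inv_four_mem hp2)) hc, by
    rw [h]; ring⟩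

theorem sineProd_neg_quarter_modEq (hp2 : p ≠ 2) {k : ℕ} (hk : k < p) :
    RatModEq p 2 (sineProd (-((p : ℚ) / 4)) k) 1 := by
  induction k with
  | zero => exact .of_eq (by simp [sineProd])
  | succ k ih =>
    have h := ih (by omega)
    have hi := inv_succ_mem hk
    refine .trans (.of_sub_eq_quarter_sq hp2
      (c := -(sineProd (-((p : ℚ) / 4)) k * (((k : ℚ) + 1)⁻¹ * ((k : ℚ) + 1)⁻¹)))
      (neg_mem (mul_mem (h.mem (one_mem _)) (mul_mem hi hi))) ?_) h
    rw [sineProd_succ]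
    field_simp
    ring

theorem binomProd_neg_quarter_modEq (hp2 : p ≠ 2) {k : ℕ} (hk : k + 1 < p) :
    RatModEq p 2 (binomProd (-((p : ℚ) / 4)) (k + 1)) ((p : ℚ) / 4 * (1 / ((k : ℚ) + 1))) := by
  have ht := quarter_mem hp2
  have hi := inv_succ_mem hk
  rw [binomProd_succ_eq_sineProd]
  set t := (p : ℚ) / 4 with htd
  have h0 : (k : ℚ) + 1 ≠ 0 := by positivity
  have hk1 : (k : ℚ) + 1 ∈ localRing p := add_mem (natCast_mem _ k) (one_mem _)
  have h := (sineProd_neg_quarter_modEq hp2 (k := k) (by omega)).mul_left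
    (mul_mem (mul_mem ht (sub_mem hk1 ht)) (mul_mem hi hi))
  refine .trans (.trans (.of_eq ?_) h) (.of_sub_eq_quarter_sq hp2
    (neg_mem (mul_mem hi hi)) ?_)
  · rw [← htd]
    field_simp
    ring
  · rw [← htd]
    field_simp
    ring

theorem sum_binomProd_neg_quarter_modEq (hp2 : p ≠ 2) {m : ℕ} (hm : m < p) :
    RatModEq p 2 (∑ k ∈ range (m + 1), binomProd (-((p : ℚ) / 4)) k)
      (1 + (p : ℚ) / 4 * ∑ k ∈ range m, 1 / ((k : ℚ) + 1)) := by
  rw [sum_range_succ', mul_sum, add_comm]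
  refine .add (.of_eq (by simp [binomProd])) (.sum fun i hi => ?_)
  exact binomProd_neg_quarter_modEq hp2 (by have := mem_range.1 hi; omega)

/-- The factor with index `j + 1` is the one divisible by `p`. Induction on `j` by
`sineProd_add_one` starts from `sineProd (-p/4) m ≡ 1`. -/
theorem sineProd_sub_quarter_modEq {m : ℕ} (hm : p = 2 * m + 1) {j : ℕ} (hj : j < m) :
    RatModEq p 2 (sineProd ((j : ℚ) + 1 - (p : ℚ) / 4) m) (-((p : ℚ) / 4) / ((j : ℚ) + 1)) := by
  have hp2 : p ≠ 2 := by omega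
  have ht := quarter_mem hp2
  have hmq : 2 * (m : ℚ) + 1 = 4 * ((p : ℚ) / 4) := by rw [hm]; push_cast; ring
  have hlt {l : ℕ} (h0 : 0 < l) (hl : l < p) : ¬ (p : ℤ) ∣ 4 * (l : ℤ) := by
    intro h
    norm_cast at h
    rcases hp.out.dvd_mul.1 h with h | h
    · exact hp2 ((Nat.prime_dvd_prime_iff_eq hp.out Nat.prime_two).1
        (hp.out.dvd_of_dvd_pow (n := 2) (by simpa using h)))
    · exact Nat.not_dvd_of_pos_of_lt h0 hl h
  have hcancel {j : ℕ} (hj : j < m) {y z : ℚ} (h : RatModEq p 2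
      (y * (((m : ℚ) - (j - (p : ℚ) / 4)) * (j - (p : ℚ) / 4 + 1)))
      (z * (((m : ℚ) - (j - (p : ℚ) / 4)) * (j - (p : ℚ) / 4 + 1)))) : RatModEq p 2 y z := by
    -- Four times each factor to be cancelled is an integer prime to `p`, because `m - j` and `j +
    -- 1` lie strictly between `0` and `p`.
    have ha : ¬ (p : ℤ) ∣ 4 * ((m - j : ℕ) : ℤ) + p := by
      rw [dvd_add_left (dvd_refl _)]
      exact hlt (by omega) (by omega)
    have hb : ¬ (p : ℤ) ∣ 4 * ((j + 1 : ℕ) : ℤ) - p := by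
      rw [dvd_sub_left (dvd_refl _)]
      exact hlt (by omega) (by omega)
    have ha0 : ((4 * ((m - j : ℕ) : ℤ) + p : ℤ) : ℚ) ≠ 0 := by
      intro h; exact ha (by rw [Int.cast_eq_zero.1 h]; exact dvd_zero _)
    have hb0 : ((4 * ((j + 1 : ℕ) : ℤ) - p : ℤ) : ℚ) ≠ 0 := by
      intro h; exact hb (by rw [Int.cast_eq_zero.1 h]; exact dvd_zero _)
    refine .of_mul_left (mul_ne_zero ha0 hb0)
      (by rw [mul_inv]; exact mul_mem (inv_intCast_mem ha) (inv_intCast_mem hb)) ?_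
    have h16 := h.mul_left (natCast_mem _ 16)
    push_cast [Nat.cast_sub hj.le] at h16 ⊢
    convert h16 using 1 <;> ring
  induction j with
  | zero =>
    refine hcancel hj ?_
    have e := sineProd_add_one (((0 : ℕ) : ℚ) - (p : ℚ) / 4) m
    rw [show ((0 : ℕ) : ℚ) - (p : ℚ) / 4 + 1 = ((0 : ℕ) : ℚ) + 1 - (p : ℚ) / 4 by ring] at e ⊢
    rw [e]
    have h := (sineProd_neg_quarter_modEq hp2 (k := m) (by omega)).mul_left
      (mul_mem ht (sub_mem (add_mem (natCast_mem _ m) (one_mem _)) ht))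
    refine .trans (.trans (.of_eq ?_) h) (.of_sub_eq_quarter_sq hp2 (c := 4 - m - (p : ℚ) / 4)
      (sub_mem (sub_mem (natCast_mem _ 4) (natCast_mem _ m)) ht) ?_)
    · push_cast
      rw [zero_sub]
      ring
    · push_cast
      linear_combination (p : ℚ) / 4 * hmq
  | succ j ih =>
    refine hcancel hj ?_
    have e := sineProd_add_one (((j + 1 : ℕ) : ℚ) - (p : ℚ) / 4) m
    rw [show ((j + 1 : ℕ) : ℚ) - (p : ℚ) / 4 + 1 = ((j + 1 : ℕ) : ℚ) + 1 - (p : ℚ) / 4 by ring] at e ⊢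
    rw [e]
    have hi1 := inv_succ_mem (p := p) (k := j) (by omega)
    have hi2 := inv_succ_mem (p := p) (k := j + 1) (by omega)
    have h1 : (j : ℚ) + 1 ≠ 0 := by positivity
    have h2 : (j : ℚ) + 1 + 1 ≠ 0 := by positivity
    set t := (p : ℚ) / 4 with htd
    have hj1 : ((j + 1 : ℕ) : ℚ) ∈ localRing p := natCast_mem _ _
    have hmm : (m : ℚ) ∈ localRing p := natCast_mem _ _
    have hx := sub_mem hj1 ht
    have h := (ih (by omega)).mul_left (c := -(((j + 1 : ℕ) : ℚ) - t) *
      (m + (((j + 1 : ℕ) : ℚ) - t) + 1))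
      (mul_mem (neg_mem hx) (add_mem (add_mem hmm hx) (one_mem _)))
    -- With `x = j + 1 - t`, the part of the difference linear in `t` is `t((m+x+1) + (m-x)) =
    -- t(2m+1) = 4t²`; this is the `4` in `c`, and the rest of `c` collects the remaining `t²`
    -- terms.
    refine .trans (.trans (.of_eq ?_) h) (.of_sub_eq_quarter_sq hp2
      (c := 4 - ((m + (((j + 1 : ℕ) : ℚ) - t) + 1) * ((j : ℚ) + 1)⁻¹ +
        (m - (((j + 1 : ℕ) : ℚ) - t)) * (((j + 1 : ℕ) : ℚ) + 1)⁻¹))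
      (sub_mem (natCast_mem _ 4) (add_mem
        (mul_mem (add_mem (add_mem hmm hx) (one_mem _)) hi1)
        (mul_mem (sub_mem hmm hx) hi2))) ?_)
    · push_cast
      ring
    · rw [← htd]
      push_cast
      field_simp
      linear_combination t * ((j : ℚ) + 1) * ((j : ℚ) + 1 + 1) * hmq

/-- Each unit step replaces `S` by `2 * sineProd - S`: the sign alternates and the sine product
supplies one term of the alternating sum. -/
theorem sum_binomProd_sub_quarter_modEq {m : ℕ} (hm : p = 2 * m + 1) {n : ℕ} (hn : n ≤ m) :
    RatModEq p 2 (∑ k ∈ range (m + 1), binomProd ((n : ℚ) - (p : ℚ) / 4) k)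
      ((-1) ^ n * (1 + (p : ℚ) / 4 * (∑ k ∈ range m, 1 / ((k : ℚ) + 1) +
        2 * ∑ j ∈ range n, (-1) ^ j / ((j : ℚ) + 1)))) := by
  induction n with
  | zero =>
    have := sum_binomProd_neg_quarter_modEq (p := p) (m := m) (by omega) (by omega)
    simpa using this
  | succ n ih =>
    have e := sum_binomProd_add_sum_binomProd_sub_one ((n : ℚ) + 1 - (p : ℚ) / 4) m
    rw [show (n : ℚ) + 1 - (p : ℚ) / 4 - 1 = n - (p : ℚ) / 4 by ring] at e
    have h := ((sineProd_sub_quarter_modEq hm (j := n) (by omega)).mul_left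
      (natCast_mem _ 2)).sub (ih (by omega))
    have hs : ((-1 : ℚ) ^ n) ^ 2 = 1 := by rw [← pow_mul, mul_comm, pow_mul]; simp
    convert h using 1
    · push_cast
      linear_combination e
    · rw [sum_range_succ, pow_succ]
      push_cast
      linear_combination (-(p : ℚ) / 2 / ((n : ℚ) + 1)) * hs

end TruncatedSum

/-! ### Pell numbers and the ring `ℤ[√2]`. -/

section Pell

/-- The half companion Pell numbers: `(1 + √2) ^ n = halfPell n + pellSeq n * √2`. -/
def halfPell (n : ℕ) : ℤ := pellSeq (n + 1) - pellSeq n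

theorem pellSeq_succ (n : ℕ) : pellSeq (n + 1) = halfPell n + pellSeq n := by
  rw [halfPell]; ring

theorem halfPell_succ (n : ℕ) : halfPell (n + 1) = halfPell n + 2 * pellSeq n := by
  rw [halfPell, halfPell, pellSeq]; ring

theorem halfPell_sq_sub (n : ℕ) : halfPell n ^ 2 - 2 * pellSeq n ^ 2 = (-1) ^ n := by
  induction n with
  | zero => simp [halfPell, pellSeq]
  | succ n ih => rw [pellSeq_succ, halfPell_succ, pow_succ]; linear_combination -ih

theorem pell_add (m n : ℕ) :
    halfPell (m + n) = halfPell m * halfPell n + 2 * pellSeq m * pellSeq n ∧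
      pellSeq (m + n) = halfPell m * pellSeq n + pellSeq m * halfPell n := by
  induction n with
  | zero => simp [halfPell, pellSeq]
  | succ n ih =>
    rw [← add_assoc, pellSeq_succ, halfPell_succ, pellSeq_succ, halfPell_succ, ih.1, ih.2]
    constructor <;> ring

theorem pellSeq_two_mul (n : ℕ) : pellSeq (2 * n) = 2 * halfPell n * pellSeq n := by
  rw [two_mul, (pell_add n n).2]; ring

theorem one_add_sqrt_two_pow (n : ℕ) :
    ((1 + Zsqrtd.sqrtd : ℤ√2)) ^ n = ⟨halfPell n, pellSeq n⟩ := by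
  induction n with
  | zero => ext <;> simp [halfPell, pellSeq]
  | succ n ih =>
    rw [pow_succ, ih, pellSeq_succ, halfPell_succ]
    ext <;> simp

/-- Frobenius in `ℤ[√2]`: `(1 + √2)^p ≡ 1 + 2^m √2` mod `p`. -/
theorem pell_prime_modEq {p m : ℕ} (hp : p.Prime) (hm : p = 2 * m + 1) :
    (p : ℤ) ∣ halfPell p - 1 ∧ (p : ℤ) ∣ pellSeq p - 2 ^ m := by
  obtain ⟨r, hr⟩ := exists_add_pow_prime_eq hp (1 : ℤ√2) Zsqrtd.sqrtd
  have h2 : (Zsqrtd.sqrtd : ℤ√2) ^ p = ((2 ^ m : ℤ) : ℤ√2) * Zsqrtd.sqrtd := by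
    rw [hm, pow_succ, pow_mul, pow_two, Zsqrtd.dmuld]
    push_cast
    rfl
  rw [one_add_sqrt_two_pow, h2] at hr
  have hre := congrArg Zsqrtd.re hr
  have him := congrArg Zsqrtd.im hr
  simp only [one_pow, Zsqrtd.re_add, Zsqrtd.im_add, Zsqrtd.re_one, Zsqrtd.im_one, Zsqrtd.re_mul,
    Zsqrtd.im_mul, Zsqrtd.re_intCast, Zsqrtd.im_intCast, Zsqrtd.re_sqrtd, Zsqrtd.im_sqrtd,
    Zsqrtd.re_natCast, Zsqrtd.im_natCast] at hre him
  have e1 : halfPell p - 1 = p * (2 * r.im) := by linear_combination hre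
  have e2 : pellSeq p - 2 ^ m = p * r.re := by linear_combination him
  exact ⟨Dvd.intro _ e1.symm, Dvd.intro _ e2.symm⟩

theorem prime_dvd_pellSeq_pred {p m : ℕ} (hp : p.Prime) (hm : p = 2 * m + 1)
    (h2 : (p : ℤ) ∣ 2 ^ m - 1) : (p : ℤ) ∣ pellSeq (p - 1) := by
  obtain ⟨ha, hb⟩ := pell_prime_modEq hp hm
  have e : p = p - 1 + 1 := by omega
  have e1 : halfPell p = halfPell (p - 1) + 2 * pellSeq (p - 1) := by
    conv_lhs => rw [e, halfPell_succ]
  have e2 : pellSeq p = halfPell (p - 1) + pellSeq (p - 1) := by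
    conv_lhs => rw [e, pellSeq_succ]
  have := dvd_sub (dvd_sub ha hb) h2
  rwa [show halfPell p - 1 - (pellSeq p - 2 ^ m) - (2 ^ m - 1) = pellSeq (p - 1) by
    rw [e1, e2]; ring] at this

theorem prime_dvd_pellSeq_succ {p m : ℕ} (hp : p.Prime) (hm : p = 2 * m + 1)
    (h2 : (p : ℤ) ∣ 2 ^ m + 1) : (p : ℤ) ∣ pellSeq (p + 1) := by
  obtain ⟨ha, hb⟩ := pell_prime_modEq hp hm
  have := dvd_add (dvd_add ha hb) h2
  rwa [show halfPell p - 1 + (pellSeq p - 2 ^ m) + (2 ^ m + 1) = pellSeq (p + 1) by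
    rw [pellSeq_succ]; ring] at this

end Pell

/-! ### Signed binomial sums in terms of Pell numbers. -/

section BinomialSums

open Finset

/-- The sign `(-1) ^ (i / 4)` on multiples of four, zero elsewhere. -/
def quarterSign (i : ℕ) : ℤ := if i % 4 = 0 then (-1) ^ (i / 4) else 0

theorem quarterSign_add_four (i : ℕ) : quarterSign (i + 4) = -quarterSign i := by
  simp only [quarterSign, Nat.add_mod_right]
  rw [show (i + 4) / 4 = i / 4 + 1 by omega, pow_succ]
  split_ifs <;> simp

/-- The binomial sum `∑ binom n i * quarterSign (i + k)`. -/
def signedBinomSum (n k : ℕ) : ℤ :=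
  ∑ ij ∈ antidiagonal n, (n.choose ij.1 : ℤ) * quarterSign (ij.1 + k)

theorem signedBinomSum_eq_sum_range (n : ℕ) :
    signedBinomSum n 0 = ∑ i ∈ range (n + 1), (n.choose i : ℤ) * quarterSign i := by
  rw [signedBinomSum, Nat.sum_antidiagonal_eq_sum_range_succ
    (fun i _ => (n.choose i : ℤ) * quarterSign (i + 0))]
  rfl

theorem signedBinomSum_succ (n k : ℕ) :
    signedBinomSum (n + 1) k = signedBinomSum n k + signedBinomSum n (k + 1) := by
  have := sum_antidiagonal_choose_succ_mul (fun i _ => quarterSign (i + k)) n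
  rw [signedBinomSum, this, signedBinomSum, signedBinomSum]
  congr 1
  refine sum_congr rfl fun ij hij => ?_
  rw [← mem_antidiagonal.1 hij, Nat.choose_symm_add, show ij.1 + 1 + k = ij.1 + (k + 1) by ring]

/-- Let `E` be the index shift, so `E^4 = -1` on `quarterSign` and the sum is `(1+E)^(8s)` applied
to it. Then `E - E^3 = E + E⁻¹` squares to `2`, so it acts as `√2`, and `(1+E)^2 = E √2 (1+√2)`
gives `(1+E)^8 = -4 (1+√2)^4`. -/
theorem signedBinomSum_eight_mul (s k : ℕ) : signedBinomSum (8 * s) k =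
    (-4) ^ s * (halfPell (4 * s) * quarterSign k +
      pellSeq (4 * s) * (quarterSign (k + 1) - quarterSign (k + 3))) := by
  induction s generalizing k with
  | zero => simp [signedBinomSum, halfPell, pellSeq]
  | succ s ih =>
    rw [show 8 * (s + 1) = 8 * s + 1 + 1 + 1 + 1 + 1 + 1 + 1 + 1 by ring,
      show 4 * (s + 1) = 4 * s + 1 + 1 + 1 + 1 by ring]
    simp only [signedBinomSum_succ, ih, pellSeq_succ, halfPell_succ, add_assoc, Nat.reduceAdd]
    have h4 := quarterSign_add_four k
    have h5 := quarterSign_add_four (k + 1)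
    have h6 := quarterSign_add_four (k + 2)
    have h7 := quarterSign_add_four (k + 3)
    have h8 := quarterSign_add_four (k + 4)
    have h9 := quarterSign_add_four (k + 5)
    have h10 := quarterSign_add_four (k + 6)
    have h11 := quarterSign_add_four (k + 7)
    simp only [add_assoc, Nat.reduceAdd] at h5 h6 h7 h8 h9 h10 h11
    rw [h11, h10, h9, h8, h7, h6, h5, h4, pow_succ]
    ring

end BinomialSums

/-! ### Binomial and harmonic sums modulo `p²`. -/

section BinomialCongruences

open Finset

variable {p : ℕ} [hp : Fact p.Prime]

theorem prime_dvd_choose_pred_sub {i : ℕ} (hi : i < p) :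
    (p : ℤ) ∣ ((p - 1).choose i : ℤ) - (-1) ^ i := by
  induction i with
  | zero => simp
  | succ i ih =>
    have h1 : (p : ℤ) ∣ (p.choose (i + 1) : ℤ) :=
      Int.natCast_dvd_natCast.2 (hp.out.dvd_choose_self (by omega) hi)
    have e : p.choose (i + 1) = (p - 1).choose i + (p - 1).choose (i + 1) := by
      rw [← Nat.choose_succ_succ, Nat.succ_eq_add_one, Nat.sub_add_cancel hp.out.one_le]
    have := dvd_sub h1 (ih (by omega))
    rwa [e, show (((p - 1).choose i + (p - 1).choose (i + 1) : ℕ) : ℤ) -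
      (((p - 1).choose i : ℤ) - (-1) ^ i) = ((p - 1).choose (i + 1) : ℤ) - (-1) ^ (i + 1) by
      push_cast; ring] at this

/-- Absorption: `(i+1) binom p (i+1) = p binom (p-1) i`, and `binom (p-1) i ≡ (-1)^i` mod `p`. -/
theorem choose_prime_modEq {i : ℕ} (hi : i + 1 < p) :
    RatModEq p 2 (p.choose (i + 1)) (p * ((-1) ^ i / ((i : ℚ) + 1))) := by
  have h : RatModEq p 1 (((p - 1).choose i : ℤ) : ℚ) (((-1) ^ i : ℤ) : ℚ) :=
    .of_int_modEq (by simpa using prime_dvd_choose_pred_sub (p := p) (i := i) (by omega))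
  have h' := (h.mul_left (inv_succ_mem hi)).prime_mul
  have e : (p : ℚ) * (p - 1).choose i = p.choose (i + 1) * (i + 1) := by
    have := Nat.add_one_mul_choose_eq (p - 1) i
    rw [Nat.sub_add_cancel hp.out.one_le] at this
    exact_mod_cast this
  have h0 : (i : ℚ) + 1 ≠ 0 := by positivity
  convert h' using 1
  · push_cast
    field_simp
    linear_combination -e
  · push_cast
    ring

/-- Pair `1/i` with `1/(p-i)`: each pair sums to `p/(i(p-i))`. -/
theorem harmonic_pred_modEq {m : ℕ} (hm : p = 2 * m + 1) :
    RatModEq p 1 (∑ i ∈ range (2 * m), 1 / ((i : ℚ) + 1)) 0 := by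
  have h2 : ((2 : ℕ) : ℚ)⁻¹ ∈ localRing p := by
    refine inv_natCast_mem fun h => ?_
    have := (Nat.prime_dvd_prime_iff_eq hp.out Nat.prime_two).1 h
    omega
  have hr := sum_range_reflect (fun i : ℕ => 1 / ((i : ℚ) + 1)) (2 * m)
  refine .of_mul_left (c := ((2 : ℕ) : ℚ)) (by norm_num) h2 (ratModEq_iff.2
    ⟨∑ i ∈ range (2 * m), ((i : ℚ) + 1)⁻¹ * (((2 * m - 1 - i : ℕ) : ℚ) + 1)⁻¹,
      sum_mem fun i hi => ?_, ?_⟩)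
  · have := mem_range.1 hi
    exact mul_mem (inv_succ_mem (by omega)) (inv_succ_mem (by omega))
  · have : ∑ i ∈ range (2 * m), (1 / ((i : ℚ) + 1) + 1 / (((2 * m - 1 - i : ℕ) : ℚ) + 1)) =
        (p : ℚ) ^ 1 * ∑ i ∈ range (2 * m),
          ((i : ℚ) + 1)⁻¹ * (((2 * m - 1 - i : ℕ) : ℚ) + 1)⁻¹ := by
      rw [mul_sum]
      refine sum_congr rfl fun i hi => ?_
      have hi := mem_range.1 hi
      have hq : ((i : ℚ) + 1) + (((2 * m - 1 - i : ℕ) : ℚ) + 1) = p := by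
        norm_cast; omega
      have h0 : (i : ℚ) + 1 ≠ 0 := by positivity
      have h1 : ((2 * m - 1 - i : ℕ) : ℚ) + 1 ≠ 0 := by positivity
      rw [← hq]
      field_simp
      ring
    rw [← this, sum_add_distrib, hr]
    push_cast
    ring

theorem sum_alternating_inv_two_mul (m : ℕ) :
    ∑ i ∈ range (2 * m), (-1 : ℚ) ^ i / ((i : ℚ) + 1) =
      ∑ i ∈ range (2 * m), 1 / ((i : ℚ) + 1) - ∑ i ∈ range m, 1 / ((i : ℚ) + 1) := by
  induction m with
  | zero => simp
  | succ m ih =>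
    rw [show 2 * (m + 1) = 2 * m + 1 + 1 by ring]
    simp only [sum_range_succ _ (2 * m + 1), sum_range_succ _ (2 * m), sum_range_succ _ m, ih]
    rw [pow_succ, pow_mul]
    have h0 : (m : ℚ) + 1 ≠ 0 := by positivity
    have h1 : 2 * (m : ℚ) + 1 + 1 ≠ 0 := by positivity
    have h : 1 / ((m : ℚ) + 1) = 2 * (1 / (2 * (m : ℚ) + 1 + 1)) := by
      field_simp; ring
    push_cast
    rw [h]
    ring

/-- Sum the inner binomial coefficients of row `p`: the alternating sum is `H_{p-1} - H_m`, and `p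
H_{p-1}` vanishes mod `p²`. -/
theorem two_pow_prime_modEq {m : ℕ} (hm : p = 2 * m + 1) :
    RatModEq p 2 (2 ^ p - 2) (-(p * ∑ i ∈ range m, 1 / ((i : ℚ) + 1))) := by
  have e : (2 : ℚ) ^ p - 2 = ∑ i ∈ range (2 * m), (p.choose (i + 1) : ℚ) := by
    have := Nat.sum_range_choose p
    rw [sum_range_succ', hm, sum_range_succ, Nat.choose_self, ← hm] at this
    have h : ((∑ i ∈ range (2 * m), p.choose (i + 1) + 1 + p.choose 0 : ℕ) : ℚ) =
        ((2 ^ p : ℕ) : ℚ) := by rw [this]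
    push_cast [Nat.choose_zero_right] at h
    linear_combination -h
  have h1 : RatModEq p 2 (∑ i ∈ range (2 * m), (p.choose (i + 1) : ℚ))
      (∑ i ∈ range (2 * m), p * ((-1) ^ i / ((i : ℚ) + 1))) :=
    .sum fun i hi => choose_prime_modEq (by have := mem_range.1 hi; omega)
  rw [← mul_sum, sum_alternating_inv_two_mul] at h1
  rw [e]
  refine h1.trans ?_
  convert ((harmonic_pred_modEq hm).prime_mul).sub
    (.refl (p * ∑ i ∈ range m, 1 / ((i : ℚ) + 1))) using 1 <;> ring

theorem sum_range_mul_quarterSign (c : ℕ → ℤ) (n : ℕ) :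
    ∑ i ∈ range (4 * n + 1), c i * quarterSign i =
      c 0 + ∑ j ∈ range n, c (4 * j + 3 + 1) * (-1) ^ (j + 1) := by
  induction n with
  | zero => simp [quarterSign]
  | succ n ih =>
    rw [show 4 * (n + 1) + 1 = 4 * n + 1 + 1 + 1 + 1 + 1 by ring]
    simp only [sum_range_succ _ (4 * n + 1 + 1 + 1 + 1), sum_range_succ _ (4 * n + 1 + 1 + 1),
      sum_range_succ _ (4 * n + 1 + 1), sum_range_succ _ (4 * n + 1), ih, sum_range_succ _ n]
    have h1 : quarterSign (4 * n + 1) = 0 := if_neg (by omega)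
    have h2 : quarterSign (4 * n + 1 + 1) = 0 := if_neg (by omega)
    have h3 : quarterSign (4 * n + 1 + 1 + 1) = 0 := if_neg (by omega)
    have h4 : quarterSign (4 * n + 1 + 1 + 1 + 1) = (-1) ^ (n + 1) := by
      rw [quarterSign, if_pos (by omega)]; congr 1; omega
    rw [h1, h2, h3, h4]
    ring

theorem signedBinomSum_eq (hp2 : p ≠ 2) : signedBinomSum p 0 =
    1 + ∑ j ∈ range (p / 4), (p.choose (4 * j + 3 + 1) : ℤ) * (-1) ^ (j + 1) := by
  rw [signedBinomSum_eq_sum_range]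
  have h := sum_range_mul_quarterSign (fun i => (p.choose i : ℤ)) (p / 4)
  simp only [Nat.choose_zero_right, Nat.cast_one] at h
  rw [← h]
  refine (sum_subset (range_subset_range.2 (by omega)) fun i hi hi' => ?_).symm
  rw [mem_range] at hi hi'
  have hodd := hp.out.eq_two_or_odd
  rw [quarterSign, if_neg (by omega), mul_zero]

theorem signedBinomSum_modEq (hp2 : p ≠ 2) :
    RatModEq p 2 (((signedBinomSum p 0 : ℤ) : ℚ) - 1)
      (p * (4⁻¹ * ∑ j ∈ range (p / 4), (-1) ^ j / ((j : ℚ) + 1))) := by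
  rw [signedBinomSum_eq hp2]
  push_cast
  rw [add_sub_cancel_left, mul_sum, mul_sum]
  refine .sum fun j hj => ?_
  have hj := mem_range.1 hj
  have hodd := hp.out.eq_two_or_odd
  have hlt : 4 * j + 3 + 1 < p := by omega
  have h0 : (j : ℚ) + 1 ≠ 0 := by positivity
  convert (choose_prime_modEq hlt).mul_left (c := (((-1) ^ (j + 1) : ℤ) : ℚ)) (intCast_mem _ _)
    using 1
  · push_cast
    ring
  · have h3 : (-1 : ℚ) ^ (4 * j + 3) = -1 := by
      rw [pow_add, pow_mul]; norm_num
    rw [h3]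
    push_cast
    rw [pow_succ, show 4 * (j : ℚ) + 3 + 1 = 4 * (j + 1) by ring]
    field_simp

theorem prime_dvd_signedBinomSum_sub_one (hp2 : p ≠ 2) :
    (p : ℤ) ∣ signedBinomSum p 0 - 1 := by
  rw [signedBinomSum_eq hp2, add_sub_cancel_left]
  refine dvd_sum fun j hj => Dvd.dvd.mul_right (Int.natCast_dvd_natCast.2
    (hp.out.dvd_choose_self (by omega) ?_)) _
  have hj := mem_range.1 hj
  have hodd := hp.out.eq_two_or_odd
  omega

end BinomialCongruences

/-! ### The square of the signed binomial sum modulo `p²`. -/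

section PellSquare

/-- This and its three analogues give the shape `σ 2^m (1 + P) + 3·2^b C²` required by
`prime_sq_dvd_of_sq_eq`, one for each odd class mod `8`. Each unrolls `signedBinomSum_eight_mul` and
uses that `(1+√2)^(4s)` has norm `1`. -/
theorem signedBinomSum_sq_eight_mul_add_one (s : ℕ) :
    signedBinomSum (8 * s + 1) 0 ^ 2 =
      2 ^ (4 * s) * (1 + pellSeq (8 * s)) + 3 * 2 ^ (4 * s) * pellSeq (4 * s) ^ 2 := by
  have hN := halfPell_sq_sub (4 * s)
  rw [pow_mul (-1 : ℤ)] at hN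
  have hu : ((-4 : ℤ) ^ s) ^ 2 = 2 ^ (4 * s) := by
    rw [← pow_mul, mul_comm s 2, pow_mul, pow_mul]; norm_num
  rw [show 8 * s = 2 * (4 * s) by ring, pellSeq_two_mul, show 2 * (4 * s) = 8 * s by ring]
  simp only [signedBinomSum_succ, signedBinomSum_eight_mul]
  simp [quarterSign]
  norm_num at hN
  linear_combination (halfPell (4 * s) + pellSeq (4 * s)) ^ 2 * hu + 2 ^ (4 * s) * hN

theorem signedBinomSum_sq_eight_mul_add_three (s : ℕ) :
    signedBinomSum (8 * s + 3) 0 ^ 2 =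
      -2 ^ (4 * s + 1) * (1 + pellSeq (8 * s + 4)) +
        3 * 2 ^ (4 * s) * halfPell (4 * s + 2) ^ 2 := by
  have hN := halfPell_sq_sub (4 * s)
  rw [pow_mul (-1 : ℤ)] at hN
  have hu : ((-4 : ℤ) ^ s) ^ 2 = 2 ^ (4 * s) := by
    rw [← pow_mul, mul_comm s 2, pow_mul, pow_mul]; norm_num
  rw [show 8 * s + 4 = 2 * (4 * s + 1 + 1) by ring, pellSeq_two_mul,
    show 8 * s + 3 = 8 * s + 1 + 1 + 1 by ring, show 4 * s + 2 = 4 * s + 1 + 1 by ring]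
  simp only [signedBinomSum_succ, signedBinomSum_eight_mul, pellSeq_succ, halfPell_succ, pow_succ]
  simp [quarterSign]
  norm_num at hN
  linear_combination (halfPell (4 * s) + 2 * pellSeq (4 * s)) ^ 2 * hu - 2 * 2 ^ (4 * s) * hN

theorem signedBinomSum_sq_eight_mul_add_five (s : ℕ) :
    signedBinomSum (8 * s + 5) 0 ^ 2 =
      -2 ^ (4 * s + 2) * (1 + pellSeq (8 * s + 6)) +
        3 * 2 ^ (4 * s + 2) * pellSeq (4 * s + 3) ^ 2 := by
  have hN := halfPell_sq_sub (4 * s)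
  rw [pow_mul (-1 : ℤ)] at hN
  have hu : ((-4 : ℤ) ^ s) ^ 2 = 2 ^ (4 * s) := by
    rw [← pow_mul, mul_comm s 2, pow_mul, pow_mul]; norm_num
  rw [show 8 * s + 6 = 2 * (4 * s + 1 + 1 + 1) by ring, pellSeq_two_mul,
    show 8 * s + 5 = 8 * s + 1 + 1 + 1 + 1 + 1 by ring, show 4 * s + 3 = 4 * s + 1 + 1 + 1 by ring,
    show 4 * s + 2 = 4 * s + 1 + 1 by ring]
  simp only [signedBinomSum_succ, signedBinomSum_eight_mul, pellSeq_succ, halfPell_succ, pow_succ]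
  simp [quarterSign]
  norm_num at hN
  linear_combination 4 * (2 * halfPell (4 * s) + 3 * pellSeq (4 * s)) ^ 2 * hu
    - 4 * 2 ^ (4 * s) * hN

theorem signedBinomSum_sq_eight_mul_add_seven (s : ℕ) :
    signedBinomSum (8 * s + 7) 0 ^ 2 =
      2 ^ (4 * s + 3) * (1 + pellSeq (8 * s + 6)) +
        3 * 2 ^ (4 * s + 2) * halfPell (4 * s + 3) ^ 2 := by
  have hN := halfPell_sq_sub (4 * s)
  rw [pow_mul (-1 : ℤ)] at hN
  have hu : ((-4 : ℤ) ^ s) ^ 2 = 2 ^ (4 * s) := by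
    rw [← pow_mul, mul_comm s 2, pow_mul, pow_mul]; norm_num
  rw [show 8 * s + 6 = 2 * (4 * s + 1 + 1 + 1) by ring, pellSeq_two_mul,
    show 8 * s + 7 = 8 * s + 1 + 1 + 1 + 1 + 1 + 1 + 1 by ring,
    show 4 * s + 3 = 4 * s + 1 + 1 + 1 by ring, show 4 * s + 2 = 4 * s + 1 + 1 by ring]
  simp only [signedBinomSum_succ, signedBinomSum_eight_mul, pellSeq_succ, halfPell_succ, pow_succ]
  simp [quarterSign]
  norm_num at hN
  linear_combination 4 * (17 * halfPell (4 * s) + 24 * pellSeq (4 * s)) ^ 2 * hu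
    + 8 * 2 ^ (4 * s) * hN

/-- Mod `p`, `h` reads `1 ≡ 1 + 3·2^b C²`, so `p ∣ C` as `p > 3`. The target is then `P(σW - 1) +
3·2^b C²`, and both terms are divisible by `p²`. -/
theorem prime_sq_dvd_of_sq_eq {p : ℕ} (hp : p.Prime) (hp3 : 3 < p) {σ W P T C : ℤ} {b : ℕ}
    (hσ : σ ^ 2 = 1) (hT : (p : ℤ) ∣ T - 1) (hW : (p : ℤ) ∣ W - σ) (hP : (p : ℤ) ∣ P)
    (h : T ^ 2 = σ * W * (1 + P) + 3 * 2 ^ b * C ^ 2) : (p : ℤ) ^ 2 ∣ T ^ 2 - σ * W - P := by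
  have hpZ : Prime (p : ℤ) := Nat.prime_iff_prime_int.1 hp
  have hσW : (p : ℤ) ∣ σ * W - 1 := by
    rw [show σ * W - 1 = σ * (W - σ) by linear_combination hσ]
    exact hW.mul_left _
  have hC : (p : ℤ) ∣ 3 * 2 ^ b * C ^ 2 := by
    rw [show 3 * 2 ^ b * C ^ 2 = (T + 1) * (T - 1) - (σ * W - 1) - σ * W * P by
      linear_combination -h]
    exact dvd_sub (dvd_sub (hT.mul_left _) hσW) (hP.mul_left _)
  have hsmall {q : ℕ} (hq : q.Prime) (hqp : q < p) : ¬ (p : ℤ) ∣ (q : ℤ) := by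
    rw [Int.natCast_dvd_natCast]
    exact Nat.not_dvd_of_pos_of_lt hq.pos hqp
  have hCp : (p : ℤ) ∣ C := by
    rcases hpZ.dvd_or_dvd hC with hd | hd
    · rcases hpZ.dvd_or_dvd hd with hd | hd
      · exact absurd hd (hsmall Nat.prime_three hp3)
      · exact absurd (hpZ.dvd_of_dvd_pow hd) (hsmall (q := 2) Nat.prime_two (by omega))
    · exact hpZ.dvd_of_dvd_pow hd
  rw [show T ^ 2 - σ * W - P = P * (σ * W - 1) + 3 * 2 ^ b * C ^ 2 by linear_combination h]
  refine dvd_add ?_ ((pow_dvd_pow_of_dvd hCp 2).mul_left _)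
  rw [pow_two]
  exact mul_dvd_mul hP hσW

theorem legendreSym_two_modEq {p m : ℕ} [Fact p.Prime] (hm : p = 2 * m + 1) :
    (p : ℤ) ∣ 2 ^ m - legendreSym p 2 := by
  have h := legendreSym.eq_pow p 2
  rw [show p / 2 = m by omega] at h
  rw [← ZMod.intCast_zmod_eq_zero_iff_dvd]
  push_cast at h ⊢
  rw [h, sub_self]

theorem signedBinomSum_sq_sub_modEq {p m : ℕ} [hp : Fact p.Prime] (hp3 : 3 < p)
    (hm : p = 2 * m + 1) :
    (p : ℤ) ^ 2 ∣ signedBinomSum p 0 ^ 2 - legendreSym p 2 * 2 ^ m -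
      pellSeq ((p : ℤ) - legendreSym p 2).toNat := by
  have hT := prime_dvd_signedBinomSum_sub_one (p := p) (by omega)
  have hW := legendreSym_two_modEq hm
  have hL := legendreSym.at_two (p := p) (by omega)
  rw [ZMod.χ₈_nat_eq_if_mod_eight, if_neg (by omega)] at hL
  by_cases h : p % 8 = 1 ∨ p % 8 = 7
  · rw [if_pos h] at hL
    rw [hL] at hW ⊢
    have hP := prime_dvd_pellSeq_pred hp.out hm hW
    rw [show ((p : ℤ) - 1).toNat = p - 1 by omega]
    rcases h with h | h
    · obtain ⟨s, rfl⟩ : ∃ s, p = 8 * s + 1 := ⟨p / 8, by omega⟩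
      obtain rfl : m = 4 * s := by omega
      refine prime_sq_dvd_of_sq_eq hp.out hp3 (by norm_num) hT hW hP
        (C := pellSeq (4 * s)) (b := 4 * s) ?_
      rw [signedBinomSum_sq_eight_mul_add_one, show 8 * s + 1 - 1 = 8 * s by omega]
      ring
    · obtain ⟨s, rfl⟩ : ∃ s, p = 8 * s + 7 := ⟨p / 8, by omega⟩
      obtain rfl : m = 4 * s + 3 := by omega
      refine prime_sq_dvd_of_sq_eq hp.out hp3 (by norm_num) hT hW hP
        (C := halfPell (4 * s + 3)) (b := 4 * s + 2) ?_
      rw [signedBinomSum_sq_eight_mul_add_seven, show 8 * s + 7 - 1 = 8 * s + 6 by omega]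
      ring
  · rw [if_neg h] at hL
    rw [hL] at hW ⊢
    have hP := prime_dvd_pellSeq_succ hp.out hm (by simpa using hW)
    rw [show ((p : ℤ) - -1).toNat = p + 1 by omega]
    obtain h | h : p % 8 = 3 ∨ p % 8 = 5 := by omega
    · obtain ⟨s, rfl⟩ : ∃ s, p = 8 * s + 3 := ⟨p / 8, by omega⟩
      obtain rfl : m = 4 * s + 1 := by omega
      refine prime_sq_dvd_of_sq_eq hp.out hp3 (by norm_num) hT hW hP
        (C := halfPell (4 * s + 2)) (b := 4 * s) ?_
      rw [signedBinomSum_sq_eight_mul_add_three]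
      ring
    · obtain ⟨s, rfl⟩ : ∃ s, p = 8 * s + 5 := ⟨p / 8, by omega⟩
      obtain rfl : m = 4 * s + 2 := by omega
      refine prime_sq_dvd_of_sq_eq hp.out hp3 (by norm_num) hT hW hP
        (C := pellSeq (4 * s + 3)) (b := 4 * s + 2) ?_
      rw [signedBinomSum_sq_eight_mul_add_five]
      ring

end PellSquare

theorem theorem3p2 (p : ℕ) [Fact p.Prime] (hp3 : 3 < p) :
    RatModEq p 2
      (∑ k ∈ Finset.range ((p - 1) / 2 + 1),
        ((Nat.choose (2 * k) k : ℚ) * (Nat.choose (4 * k) (2 * k) : ℚ)) / (64 : ℚ) ^ k)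
      ((-1 : ℚ) ^ (p / 4) *
        (1 + (pellSeq ((p : ℤ) - legendreSym p 2).toNat : ℚ))) := by
  have hp2 : p ≠ 2 := by omega
  have hodd := (Fact.out : p.Prime).eq_two_or_odd
  obtain ⟨m, hm⟩ : ∃ m, p = 2 * m + 1 := ⟨p / 2, by omega⟩
  -- `⌊p/4⌋ - p/4` is `-1/4` or `-3/4` according to `p` mod `4`.
  have hx : (((p / 4 : ℕ) : ℚ) - (p : ℚ) / 4) * (((p / 4 : ℕ) : ℚ) - (p : ℚ) / 4 + 1) =
      -3 / 16 := by
    set n := p / 4 with hn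
    obtain h | h : p = 4 * n + 1 ∨ p = 4 * n + 3 := by omega
    all_goals
      have hq : (p : ℚ) = _ := congrArg Nat.cast h
      rw [hq]
      push_cast
      ring
  rw [show (p - 1) / 2 = m by omega,
    Finset.sum_congr rfl fun k _ => choose_mul_choose_div_eq_binomProd hx k]
  refine (sum_binomProd_sub_quarter_modEq hm (n := p / 4) (by omega)).trans ?_
  have hsign : (-1 : ℚ) ^ (p / 4) ∈ localRing p := pow_mem (neg_mem (one_mem _)) _
  refine .mul_left hsign (.add (.refl 1) ?_)
  have hH := (two_pow_prime_modEq hm).symm.mul_left (neg_mem (inv_four_mem hp2))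
  have hD := (signedBinomSum_modEq hp2).symm.mul_left (natCast_mem (localRing p) 2)
  set T := signedBinomSum p 0
  set P := pellSeq ((p : ℤ) - legendreSym p 2).toNat
  have hT := prime_dvd_signedBinomSum_sub_one hp2
  have hW := legendreSym_two_modEq hm
  have hσ : legendreSym p 2 ^ 2 = 1 := by
    refine legendreSym.sq_one p ?_
    rw [Ne, ZMod.intCast_zmod_eq_zero_iff_dvd]
    exact fun h => Nat.not_dvd_of_pos_of_lt two_pos (by omega) (Int.natCast_dvd_natCast.1 h)
  set σ := legendreSym p 2
  have hσq : (σ : ℚ) ^ 2 = 1 := by exact_mod_cast hσ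
  obtain ⟨a, ha⟩ := hT
  obtain ⟨b, hb⟩ := hW
  have haq : (T : ℚ) - 1 = p * a := by exact_mod_cast ha
  have hbq : (2 : ℚ) ^ m - σ = p * b := by exact_mod_cast hb
  -- Complete squares: `(T-1)²` and `(2^m - σ)²` vanish mod `p²`, while `2^p = 2(2^m)²` and `σ² =
  -- 1`.
  have hsq : RatModEq p 2 (2 * ((T : ℚ) - 1) - (2 ^ p - 2) / 4)
      ((T : ℚ) ^ 2 - σ * 2 ^ m) := by
    refine ratModEq_iff.2 ⟨-(a * a) - 4⁻¹ * (2 * (b * b)), sub_mem (neg_mem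
      (mul_mem (intCast_mem _ a) (intCast_mem _ a))) (mul_mem (inv_four_mem hp2)
      (mul_mem (natCast_mem _ 2) (mul_mem (intCast_mem _ b) (intCast_mem _ b)))), ?_⟩
    have e : (2 : ℚ) ^ p = 2 * (2 ^ m) ^ 2 := by rw [hm]; ring
    rw [e]
    have haq2 : ((T : ℚ) - 1) ^ 2 = p ^ 2 * (a * a) := by rw [haq]; ring
    have hbq2 : ((2 : ℚ) ^ m - σ) ^ 2 = p ^ 2 * (b * b) := by rw [hbq]; ring
    linear_combination -haq2 - hbq2 / 2 + hσq / 2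
  have hfin : RatModEq p 2 ((T : ℚ) ^ 2 - σ * 2 ^ m) P := by
    obtain ⟨c, hc⟩ := signedBinomSum_sq_sub_modEq hp3 hm
    refine ratModEq_iff.2 ⟨c, intCast_mem _ c, ?_⟩
    exact_mod_cast hc
  refine .trans ?_ (hsq.trans hfin)
  convert hH.add hD using 1
  · push_cast
    ring
  · push_cast
    ring
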